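/- Let $\mathcal G=\langle L,R,C,P\rangle$ be a generator system in $\mathbb R^n$: finite sets of lines, rays, closure points and points, with $0\notin L\cup R$. Let $$\mathrm{gen}(\mathcal G)=\Bigl\{\,\sum_{l\in L}\lambda_l l+\sum_{r\in R}\rho_r r+\sum_{c\in C}\gamma_c c+\sum_{p\in P}\pi_p p \;\Bigm|\; \lambda_l\in\mathbb R,\ \rho_r,\gamma_c,\pi_p\ge 0,\ \pi\neq 0,\ \sum_{c}\gamma_c+\sum_{p}\pi_p=1\,\Bigr\}$$ be the (not necessarily closed) polyhedron it generates, and let $\mathrm{full.gen}(\langle L,R,C,P\rangle)=\mathrm{gen}(\langle L,R,\emptyset,C\cup P\rangle)$. Generator systems are ordered by component-wise inclusion; a system is in minimal form if no proper subsystem generates the same polyhedron. The skeleton of a system $\langle L,R,C,P\rangle$ in minimal form is $\langle L,R,C\cup SP,\emptyset\rangle$, where $SP$ is the set of those $p\in P$ with $p\notin \mathrm{full.gen}(\langle L,R,C,P\setminus\{p\}\rangle)$. A skeleton component for an arbitrary $\mathcal G$ is the skeleton of a system in minimal form that generates $\mathrm{gen}(\mathcal G)$ (for instance of $\mathcal G$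 itself, if it is in minimal form). Let $\mathcal{SK}$ be a skeleton component and $\mathcal Q=\mathrm{full.gen}(\mathcal{SK})$. The faces of $\mathcal Q$ are the sets $F=\{x\in\mathcal Q\mid a^{\mathsf T}x=b\}$ where $a^{\mathsf T}x\ge b$ holds on $\mathcal Q$ (including $\emptyset$ and $\mathcal Q$, since $a=0$ is allowed). The support $\mathcal{SK}_F\subseteq\mathcal{SK}$ of a face $F$ consists of the lines, rays and closure points of $\mathcal{SK}$ that are, respectively, lines, rays and elements of $F$ (the empty face has no lines or rays). Let $\mathbb{NS}$ be the set of all supports $\mathcal{SK}_F$. For a set $S$ of points of $\mathcal Q$ and an upward closed set $NS\subseteq\mathbb{NS}$ put $$\alpha_{\mathcal{SK}}(S)=\bigl\{\,ns\in\mathbb{NS}\bigm| \mathcal{SK}_F\subseteq ns\text{ for some }p\in S\text{ and some face }F\text{ of }\mathcal Q\text{ with }p\in\mathrm{relint}(F)\,\bigr\},$$ $$\gamma_{\mathcal{SK}}(NS)=\bigcup_{ns\in NS}\mathrm{relint}\bigl(\mathrm{full.gen}(ns)\bigr).$$ Then every generator system $\mathcal G=\langle L,R,C,P\rangle$ has a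 skeleton component, and for every skeleton component $\mathcal{SK}$ for $\mathcal G$, with the non-skeleton component $NS=\alpha_{\mathcal{SK}}(P)$, one has $$\mathrm{gen}(\mathcal G)=\gamma_{\mathcal{SK}}(NS).$$ -/

import Mathlib

/-- A generator system `⟨L, R, C, P⟩` in `ℝⁿ`: finite sets of lines, rays, closure points and
points, where no line and no ray is the zero vector. -/
@[ext] structure GenSys (n : ℕ) where
  L : Finset (EuclideanSpace ℝ (Fin n))
  R : Finset (EuclideanSpace ℝ (Fin n))
  C : Finset (EuclideanSpace ℝ (Fin n))
  P : Finset (EuclideanSpace ℝ (Fin n))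
  zero_notMem_L : (0 : EuclideanSpace ℝ (Fin n)) ∉ L
  zero_notMem_R : (0 : EuclideanSpace ℝ (Fin n)) ∉ R

namespace GenSys

variable {n : ℕ}

/-- Generator systems are ordered by component-wise inclusion. -/
instance : PartialOrder (GenSys n) where
  le G G' := G.L ⊆ G'.L ∧ G.R ⊆ G'.R ∧ G.C ⊆ G'.C ∧ G.P ⊆ G'.P
  le_refl _ := ⟨subset_rfl, subset_rfl, subset_rfl, subset_rfl⟩
  le_trans _ _ _ h h' :=
    ⟨h.1.trans h'.1, h.2.1.trans h'.2.1, h.2.2.1.trans h'.2.2.1, h.2.2.2.trans h'.2.2.2⟩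
  le_antisymm _ _ h h' :=
    GenSys.ext (h.1.antisymm h'.1) (h.2.1.antisymm h'.2.1) (h.2.2.1.antisymm h'.2.2.1)
      (h.2.2.2.antisymm h'.2.2.2)

/-- The not necessarily closed polyhedron generated by `⟨L, R, C, P⟩`: at least one point must
have a non-zero coefficient. -/
def gen (G : GenSys n) : Set (EuclideanSpace ℝ (Fin n)) :=
  {x | ∃ lam rho gam pi : EuclideanSpace ℝ (Fin n) → ℝ,
    (∀ r ∈ G.R, 0 ≤ rho r) ∧ (∀ c ∈ G.C, 0 ≤ gam c) ∧ (∀ p ∈ G.P, 0 ≤ pi p) ∧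
    (∃ p ∈ G.P, pi p ≠ 0) ∧
    ∑ c ∈ G.C, gam c + ∑ p ∈ G.P, pi p = 1 ∧
    x = ∑ l ∈ G.L, lam l • l + ∑ r ∈ G.R, rho r • r +
        ∑ c ∈ G.C, gam c • c + ∑ p ∈ G.P, pi p • p}

open Classical in
/-- `full.gen`: the closure points are reinterpreted as points. -/
noncomputable def fullGen (G : GenSys n) : Set (EuclideanSpace ℝ (Fin n)) :=
  gen ⟨G.L, G.R, ∅, G.C ∪ G.P, G.zero_notMem_L, G.zero_notMem_R⟩

/-- `G` is in minimal form: no proper subsystem of `G` generates the same polyhedron. -/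
def IsMinimalForm (G : GenSys n) : Prop :=
  ∀ G' : GenSys n, G' ≤ G → gen G' = gen G → G' = G

open Classical in
/-- The skeleton points of `G`: the points in `P` that are not a combination of the other
generators in `G` (a combination may use closure points only). -/
noncomputable def skelPoints (G : GenSys n) : Finset (EuclideanSpace ℝ (Fin n)) :=
  G.P.filter fun p =>
    p ∉ fullGen ⟨G.L, G.R, G.C, G.P.erase p, G.zero_notMem_L, G.zero_notMem_R⟩

open Classical in
/-- The skeleton `⟨L, R, C ∪ SP, ∅⟩` of a generator system in minimal form. -/
noncomputable def skel (G : GenSys n) : GenSys n :=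
  ⟨G.L, G.R, G.C ∪ skelPoints G, ∅, G.zero_notMem_L, G.zero_notMem_R⟩

/-- `SK` is a skeleton component for `G`: it is the skeleton of a system in minimal form that
generates the same polyhedron (of `G` itself if `G` is in minimal form). -/
def IsSkeleton (SK G : GenSys n) : Prop :=
  ∃ Gm : GenSys n, Gm.IsMinimalForm ∧ gen Gm = gen G ∧ SK = skel Gm

/-- The faces `{x ∈ Q | aᵀx = b}` of `Q`, for the inequalities `aᵀx ≥ b` valid on `Q`.
The vector `a` may be zero, so that `∅` and `Q` are always faces. -/
def cFaces (Q : Set (EuclideanSpace ℝ (Fin n))) : Set (Set (EuclideanSpace ℝ (Fin n))) :=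
  {F | ∃ (a : EuclideanSpace ℝ (Fin n)) (b : ℝ),
    (∀ x ∈ Q, b ≤ inner ℝ a x) ∧ F = {x ∈ Q | inner ℝ a x = b}}

/-- `r` is a ray of `P`. The empty set has no rays. -/
def IsRay (P : Set (EuclideanSpace ℝ (Fin n))) (r : EuclideanSpace ℝ (Fin n)) : Prop :=
  r ≠ 0 ∧ P.Nonempty ∧ ∀ p ∈ P, ∀ ρ : ℝ, 0 ≤ ρ → p + ρ • r ∈ P

/-- `l` is a line of `P`. -/
def IsLine (P : Set (EuclideanSpace ℝ (Fin n))) (l : EuclideanSpace ℝ (Fin n)) : Prop :=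
  IsRay P l ∧ IsRay P (-l)

open Classical in
/-- The support `SK_F ⊆ SK` of a face `F`: the subsystem of those elements of `SK` that are
lines, rays and (closure) points of `F`. -/
noncomputable def support (SK : GenSys n) (F : Set (EuclideanSpace ℝ (Fin n))) : GenSys n :=
  ⟨SK.L.filter (IsLine F), SK.R.filter (IsRay F), SK.C.filter (· ∈ F), SK.P.filter (· ∈ F),
    fun h => SK.zero_notMem_L (Finset.mem_filter.1 h).1,
    fun h => SK.zero_notMem_R (Finset.mem_filter.1 h).1⟩

/-- The set of all supports for `SK`: all `SK_F`, where `F` is a face of `full.gen(SK)`. -/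
def supports (SK : GenSys n) : Set (GenSys n) :=
  {ns | ∃ F ∈ cFaces (fullGen SK), ns = support SK F}

/-- The abstraction function `α_SK`, with values in the upward closed sets of supports: the union
of all `↑ SK_F` such that `relint F` meets `S`, for `F` a face of `full.gen(SK)`. -/
def abstraction (SK : GenSys n) (S : Set (EuclideanSpace ℝ (Fin n))) : UpperSet (supports SK) where
  carrier := {ns | ∃ p ∈ S, ∃ F ∈ cFaces (fullGen SK),
    p ∈ intrinsicInterior ℝ F ∧ support SK F ≤ ns.1}
  upper' := fun _ _ hle ⟨p, hp, F, hF, hpF, h⟩ => ⟨p, hp, F, hF, hpF, h.trans hle⟩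

/-- The concretization function `γ_SK`. -/
def concretization (SK : GenSys n) (NS : UpperSet (supports SK)) :
    Set (EuclideanSpace ℝ (Fin n)) :=
  ⋃ ns ∈ NS, intrinsicInterior ℝ (fullGen ns.1)

/-- The non-skeleton component of `G` with respect to the skeleton `SK`: `α_SK(P)`. -/
def nonSkel (SK G : GenSys n) : UpperSet (supports SK) :=
  abstraction SK (G.P : Set (EuclideanSpace ℝ (Fin n)))

end GenSys

/-! Write `Q` for the closed polyhedron of the skeleton. An `x` in `Q` lies in `gen G` exactly when
the face `F'` of `Q` with `x` in its relative interior contains some `p ∈ G.P`. If `x ∈ gen G`, some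
`p` has a positive coefficient, so `x` is interior to a segment from `p` to another element of `gen
G`, and a face through `x` contains the whole segment. Conversely, if `p ∈ F'`, the segment from `p`
to `x` extends beyond `x` to some `y ∈ F'`. Then `x` mixes `y ∈ Q` with `p ∈ gen G`, with positive
weight on `p`, and `mix_mem_gen` applies. Supports encode this condition: a face is generated by its
support (`fullGen_support`), so supports are ordered as faces are, and `p ∈ F'` means that the face
with `p` in its relative interior lies in `F'`. Such faces exist by
`exists_face_mem_intrinsicInterior`. Minimal form enters only through `IsMinimalForm.fullGen_skel`:
passing to the skeleton does not change the closed polyhedron. -/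

/-! ### Relative interiors of convex sets -/

section IntrinsicInterior

variable {V : Type*} [NormedAddCommGroup V] [InnerProductSpace ℝ V]

/-- From a point of the relative interior one can move slightly away from any other point. -/
theorem exists_prolongation_of_mem_intrinsicInterior {s : Set V} {x p : V}
    (hx : x ∈ intrinsicInterior ℝ s) (hp : p ∈ s) :
    ∃ y ∈ s, ∃ t : ℝ, 0 < t ∧ t < 1 ∧ x = (1 - t) • y + t • p := by
  obtain ⟨x', hx', rfl⟩ := mem_intrinsicInterior.1 hx
  have : Nonempty s := ⟨⟨p, hp⟩⟩
  let p' : affineSpan ℝ s := ⟨p, subset_affineSpan ℝ s hp⟩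
  -- The line from `p` through `x`, with `x` at parameter `0` and positive parameters beyond it.
  let g : ℝ → affineSpan ℝ s := fun t => AffineMap.lineMap p' x' (1 + t)
  have hg : Continuous fun t : ℝ => ((g t : affineSpan ℝ s) : V) := by
    have : (fun t : ℝ => ((g t : affineSpan ℝ s) : V)) =
        fun t : ℝ => (1 + t) • ((x' : V) - p) + p := by
      funext t
      simp [g, p', AffineMap.lineMap_apply]
    rw [this]
    fun_prop
  have hg' : Continuous g := continuous_induced_rng.2 hg
  have h0 : g 0 = x' := by simp [g]
  have hev : ∀ᶠ t in nhds (0 : ℝ), g t ∈ ((↑) ⁻¹' s : Set (affineSpan ℝ s)) := by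
    apply hg'.continuousAt.eventually_mem
    rw [h0]
    exact mem_interior_iff_mem_nhds.1 hx'
  obtain ⟨ε, hε, hball⟩ := Metric.eventually_nhds_iff.1 hev
  have hm : g (ε / 2) ∈ ((↑) ⁻¹' s : Set (affineSpan ℝ s)) := by
    apply hball
    rw [Real.dist_eq, sub_zero, abs_of_pos (by positivity)]
    linarith
  refine ⟨_, hm, (ε / 2) / (1 + ε / 2), by positivity, ?_, ?_⟩
  · rw [div_lt_one (by positivity)]
    linarith
  · have h1 : (1 + ε / 2) ≠ 0 := by positivity
    have h2 : (ε / 2) / (1 + ε / 2) = 1 - (1 + ε / 2)⁻¹ := by field_simp; ring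
    have h3 : ((g (ε / 2) : affineSpan ℝ s) : V) = (1 + ε / 2) • ((x' : V) - p) + p := by
      simp [g, p', AffineMap.lineMap_apply]
    rw [h2, h3, sub_sub_cancel, smul_add, smul_smul, inv_mul_cancel₀ h1, one_smul]
    module

/-- A convex set has a nontrivial supporting hyperplane at each point outside its relative
interior. -/
theorem Convex.exists_supporting_of_notMem_intrinsicInterior [FiniteDimensional ℝ V] {s : Set V}
    (hs : Convex ℝ s) {x : V} (hxs : x ∈ s) (hx : x ∉ intrinsicInterior ℝ s) :
    ∃ a : V, (∀ y ∈ s, inner ℝ a x ≤ inner ℝ a y) ∧ ∃ y ∈ s, inner ℝ a x < inner ℝ a y := by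
  have : Nonempty s := ⟨⟨x, hxs⟩⟩
  let x' : affineSpan ℝ s := ⟨x, subset_affineSpan ℝ s hxs⟩
  -- Moving `x` to the origin of the direction space turns the relative interior into an ordinary
  -- nonempty interior, where Hahn–Banach separates.
  let e := AffineIsometryEquiv.vaddConst ℝ x'
  let S : Set (affineSpan ℝ s) := (↑) ⁻¹' s
  let A : Set (affineSpan ℝ s).direction := e ⁻¹' S
  have hA : Convex ℝ A :=
    hs.affine_preimage ((affineSpan ℝ s).subtype.comp e.toAffineEquiv.toAffineMap)
  have hint : interior A = e ⁻¹' interior S :=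
    (e.toHomeomorph.preimage_interior S).symm
  have hne : (interior A).Nonempty := by
    obtain ⟨z, hz⟩ := Set.Nonempty.intrinsicInterior hs ⟨x, hxs⟩
    obtain ⟨z', hz', rfl⟩ := mem_intrinsicInterior.1 hz
    refine ⟨e.symm z', ?_⟩
    rw [hint]
    simpa using hz'
  have h0 : (0 : (affineSpan ℝ s).direction) ∉ interior A := by
    rw [hint]
    intro h
    apply hx
    refine mem_intrinsicInterior.2 ⟨x', ?_, rfl⟩
    simpa [e] using h
  obtain ⟨f, hf⟩ := geometric_hahn_banach_open_point hA.interior isOpen_interior h0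
  have hfA : ∀ v ∈ A, f v ≤ 0 := by
    intro v hv
    have hv' : v ∈ closure (interior A) := by
      rw [hA.closure_interior_eq_closure_of_nonempty_interior hne]
      exact subset_closure hv
    have : closure (interior A) ⊆ {v : (affineSpan ℝ s).direction | f v ≤ 0} :=
      closure_minimal (fun v hv => by simpa using (hf v hv).le)
        (isClosed_le f.continuous continuous_const)
    exact this hv'
  let w := (InnerProductSpace.toDual ℝ (affineSpan ℝ s).direction).symm f
  have hw : ∀ v : (affineSpan ℝ s).direction, inner ℝ (w : V) (v : V) = f v := fun v => by
    rw [← Submodule.coe_inner]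
    exact InnerProductSpace.toDual_symm_apply
  refine ⟨-(w : V), fun y hy => ?_, ?_⟩
  · let v : (affineSpan ℝ s).direction :=
      ⟨y - x, AffineSubspace.vsub_mem_direction (subset_affineSpan ℝ s hy) x'.2⟩
    have hv : v ∈ A := by simpa [A, S, e, v, x'] using hy
    have h1 := hfA v hv
    rw [← hw, inner_sub_right] at h1
    rw [inner_neg_left, inner_neg_left]
    linarith
  · obtain ⟨v, hv⟩ := hne
    have hvA := interior_subset hv
    refine ⟨(e v : V), hvA, ?_⟩
    have h1 := hf v hv
    rw [map_zero, ← hw] at h1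
    have h2 : ((e v : affineSpan ℝ s) : V) = v + x := by simp [e, x']
    rw [h2, inner_add_right, inner_neg_left, inner_neg_left]
    linarith

end IntrinsicInterior

namespace GenSys

variable {n : ℕ}

/-! ### Calculus of generated polyhedra -/

section Gen

variable {G : GenSys n} {x y : EuclideanSpace ℝ (Fin n)}

theorem add_smul_ray_mem_gen (hx : x ∈ gen G) {r : EuclideanSpace ℝ (Fin n)} (hr : r ∈ G.R)
    {t : ℝ} (ht : 0 ≤ t) : x + t • r ∈ gen G := by
  classical
  obtain ⟨lam, rho, gam, pi, h1, h2, h3, h4, h5, rfl⟩ := hx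
  refine ⟨lam, fun s => rho s + if s = r then t else 0, gam, pi, fun s hs => ?_, h2, h3, h4, h5, ?_⟩
  · have := h1 s hs
    dsimp only
    split_ifs <;> linarith
  · simp only [add_smul, Finset.sum_add_distrib, ite_smul, zero_smul, Finset.sum_ite_eq', hr,
      if_true]
    abel

theorem add_smul_line_mem_gen (hx : x ∈ gen G) {l : EuclideanSpace ℝ (Fin n)} (hl : l ∈ G.L)
    (t : ℝ) : x + t • l ∈ gen G := by
  classical
  obtain ⟨lam, rho, gam, pi, h1, h2, h3, h4, h5, rfl⟩ := hx
  refine ⟨fun s => lam s + if s = l then t else 0, rho, gam, pi, h1, h2, h3, h4, h5, ?_⟩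
  simp only [add_smul, Finset.sum_add_distrib, ite_smul, zero_smul, Finset.sum_ite_eq', hl,
    if_true]
  abel

theorem mem_gen_of_mem_P (hx : x ∈ G.P) : x ∈ gen G := by
  classical
  refine ⟨0, 0, 0, fun p => if p = x then 1 else 0, by simp, by simp, ?_, ⟨x, hx, by simp⟩,
    by simp [hx], by simp [hx]⟩
  intro p _
  dsimp only
  split_ifs <;> norm_num

/-- The sum being 1 already forces a nonzero coefficient. Separate coefficients on `C` and `P`
remain valid when the two sets overlap. -/
theorem mem_fullGen_iff : x ∈ fullGen G ↔
    ∃ lam rho gam pi : EuclideanSpace ℝ (Fin n) → ℝ,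
      (∀ r ∈ G.R, 0 ≤ rho r) ∧ (∀ c ∈ G.C, 0 ≤ gam c) ∧ (∀ p ∈ G.P, 0 ≤ pi p) ∧
      ∑ c ∈ G.C, gam c + ∑ p ∈ G.P, pi p = 1 ∧
      x = ∑ l ∈ G.L, lam l • l + ∑ r ∈ G.R, rho r • r +
        ∑ c ∈ G.C, gam c • c + ∑ p ∈ G.P, pi p • p := by
  classical
  constructor
  · rintro ⟨lam, rho, gam, pi, h1, -, h3, -, h5, h6⟩
    have key : ∀ {M : Type} [AddCommMonoid M] (f : EuclideanSpace ℝ (Fin n) → M),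
        ∑ p ∈ G.C ∪ G.P, f p = ∑ p ∈ G.C, f p + ∑ p ∈ G.P, if p ∈ G.C then 0 else f p := by
      intro M _ f
      rw [← Finset.union_sdiff_self_eq_union, Finset.sum_union Finset.disjoint_sdiff,
        Finset.sdiff_eq_filter, Finset.sum_filter]
      simp only [ite_not]
    -- A vector in both sets gives its whole weight to `C`.
    refine ⟨lam, rho, pi, fun p => if p ∈ G.C then 0 else pi p, h1,
      fun c hc => h3 c (Finset.mem_union_left _ hc), fun p hp => ?_, ?_, ?_⟩
    · dsimp only
      split_ifs
      exacts [le_rfl, h3 p (Finset.mem_union_right _ hp)]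
    · simpa [key] using h5
    · rw [h6]
      simp only [Finset.sum_empty, add_zero, ite_smul, zero_smul]
      rw [key]
      abel
  · rintro ⟨lam, rho, gam, pi, h1, h2, h3, h5, h6⟩
    have key : ∀ {M : Type} [AddCommMonoid M] (f g : EuclideanSpace ℝ (Fin n) → M),
        ∑ p ∈ G.C ∪ G.P, ((if p ∈ G.C then f p else 0) + if p ∈ G.P then g p else 0) =
          ∑ p ∈ G.C, f p + ∑ p ∈ G.P, g p := by
      intro M _ f g
      rw [Finset.sum_add_distrib, Finset.sum_ite_mem, Finset.sum_ite_mem,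
        Finset.inter_eq_right.2 Finset.subset_union_left,
        Finset.inter_eq_right.2 Finset.subset_union_right]
    have hsum : ∑ p ∈ G.C ∪ G.P, ((if p ∈ G.C then gam p else 0) + if p ∈ G.P then pi p else 0) =
        1 := by rw [key, h5]
    refine ⟨lam, rho, 0, fun p => (if p ∈ G.C then gam p else 0) + if p ∈ G.P then pi p else 0,
      h1, by simp, fun p _ => ?_, ?_, by simpa using hsum, ?_⟩
    · have := h2 p
      have := h3 p
      dsimp only
      split_ifs <;> simp_all [add_nonneg]
    · exact Finset.exists_ne_zero_of_sum_ne_zero (by rw [hsum]; exact one_ne_zero)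
    · rw [h6]
      simp only [Finset.sum_empty, add_zero, add_smul, ite_smul, zero_smul]
      rw [key]
      abel

theorem gen_subset_fullGen (G : GenSys n) : gen G ⊆ fullGen G := by
  rintro x ⟨lam, rho, gam, pi, h1, h2, h3, -, h5, h6⟩
  exact mem_fullGen_iff.2 ⟨lam, rho, gam, pi, h1, h2, h3, h5, h6⟩

theorem mem_fullGen_of_mem_C (hx : x ∈ G.C) : x ∈ fullGen G := by
  classical
  exact mem_gen_of_mem_P (G := ⟨G.L, G.R, ∅, G.C ∪ G.P, G.zero_notMem_L, G.zero_notMem_R⟩)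
    (Finset.mem_union_left _ hx)

theorem mem_fullGen_of_mem_P (hx : x ∈ G.P) : x ∈ fullGen G :=
  gen_subset_fullGen G (mem_gen_of_mem_P hx)

theorem add_smul_ray_mem_fullGen (hx : x ∈ fullGen G) {r : EuclideanSpace ℝ (Fin n)}
    (hr : r ∈ G.R) {t : ℝ} (ht : 0 ≤ t) : x + t • r ∈ fullGen G :=
  add_smul_ray_mem_gen (G := ⟨_, _, _, _, _, _⟩) hx hr ht

theorem add_smul_line_mem_fullGen (hx : x ∈ fullGen G) {l : EuclideanSpace ℝ (Fin n)}
    (hl : l ∈ G.L) (t : ℝ) : x + t • l ∈ fullGen G :=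
  add_smul_line_mem_gen (G := ⟨_, _, _, _, _, _⟩) hx hl t

/-- The positive weight on `x` keeps the coefficient of one of its points nonzero, so `y` need not
use any point. -/
theorem mix_mem_gen (hy : y ∈ fullGen G) (hx : x ∈ gen G) {s t : ℝ} (hs : 0 ≤ s) (ht : 0 < t)
    (hst : s + t = 1) : s • y + t • x ∈ gen G := by
  obtain ⟨lam, rho, gam, pi, h1, h2, h3, h5, rfl⟩ := mem_fullGen_iff.1 hy
  obtain ⟨lam', rho', gam', pi', h1', h2', h3', ⟨p, hp, hp0⟩, h5', rfl⟩ := hx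
  refine ⟨fun z => s * lam z + t * lam' z, fun z => s * rho z + t * rho' z,
    fun z => s * gam z + t * gam' z, fun z => s * pi z + t * pi' z,
    fun z hz => ?_, fun z hz => ?_, fun z hz => ?_, ⟨p, hp, ?_⟩, ?_, ?_⟩
  · have := h1 z hz; have := h1' z hz; positivity
  · have := h2 z hz; have := h2' z hz; positivity
  · have := h3 z hz; have := h3' z hz; positivity
  · have := h3 p hp
    have := (h3' p hp).lt_of_ne' hp0
    positivity
  · simp only [Finset.sum_add_distrib, ← Finset.mul_sum]
    linear_combination s * h5 + t * h5' + hst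
  · simp only [add_smul, mul_smul, Finset.sum_add_distrib, ← Finset.smul_sum]
    module

theorem convex_gen (G : GenSys n) : Convex ℝ (gen G) := by
  intro x hx y hy s t hs ht hst
  obtain rfl | ht := ht.eq_or_lt
  · obtain rfl : s = 1 := by linarith
    simpa using hx
  · exact mix_mem_gen (gen_subset_fullGen G hx) hy hs ht hst

theorem convex_fullGen (G : GenSys n) : Convex ℝ (fullGen G) := convex_gen _

/-- `fullGen G` is contained in every convex set that contains the points and closure points and is
closed under adding multiples of lines and rays. -/
theorem fullGen_subset {T : Set (EuclideanSpace ℝ (Fin n))} (hT : Convex ℝ T)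
    (hL : ∀ x ∈ T, ∀ l ∈ G.L, ∀ t : ℝ, x + t • l ∈ T)
    (hR : ∀ x ∈ T, ∀ r ∈ G.R, ∀ t : ℝ, 0 ≤ t → x + t • r ∈ T)
    (hC : ∀ c ∈ G.C, c ∈ T) (hP : ∀ p ∈ G.P, p ∈ T) : fullGen G ⊆ T := by
  classical
  rintro x ⟨lam, rho, gam, pi, h1, -, h3, -, h5, rfl⟩
  simp only [Finset.sum_empty, zero_add, add_zero] at h5 ⊢
  have h0 : ∑ p ∈ G.C ∪ G.P, pi p • p ∈ T :=
    hT.sum_mem h3 h5 fun p hp => (Finset.mem_union.1 hp).elim (hC p) (hP p)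
  have hr : ∀ A ⊆ G.R, ∀ x ∈ T, x + ∑ r ∈ A, rho r • r ∈ T := by
    intro A
    induction A using Finset.induction_on with
    | empty => simp
    | insert r A hrA ih =>
      intro hA x hx
      rw [Finset.insert_subset_iff] at hA
      rw [Finset.sum_insert hrA, ← add_assoc]
      exact ih hA.2 _ (hR x hx r hA.1 _ (h1 r hA.1))
  have hl : ∀ A ⊆ G.L, ∀ x ∈ T, x + ∑ r ∈ A, lam r • r ∈ T := by
    intro A
    induction A using Finset.induction_on with
    | empty => simp
    | insert r A hrA ih =>
      intro hA x hx
      rw [Finset.insert_subset_iff] at hA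
      rw [Finset.sum_insert hrA, ← add_assoc]
      exact ih hA.2 _ (hL x hx r hA.1 _)
  have := hr _ subset_rfl _ (hl _ subset_rfl _ h0)
  convert this using 1
  abel

/-- Every element of `gen G` lies strictly between a point of `G` and an element of `gen G`. -/
theorem exists_point_of_mem_gen (hx : x ∈ gen G) :
    ∃ p ∈ G.P, ∃ y ∈ gen G, ∃ t : ℝ, 0 < t ∧ t < 1 ∧ x = (1 - t) • y + t • p := by
  classical
  obtain ⟨lam, rho, gam, pi, h1, h2, h3, ⟨p, hp, hp0⟩, h5, rfl⟩ := hx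
  have hpos : 0 < pi p := (h3 p hp).lt_of_ne' hp0
  have hle : pi p ≤ 1 := by
    have := Finset.single_le_sum h3 hp
    have := Finset.sum_nonneg h2
    linarith
  -- Only half of the weight of `p` is split off: `p` keeps a positive coefficient in `y`, and `1 -
  -- t` is positive.
  set t := pi p / 2 with ht
  have ht1 : 0 < 1 - t := by linarith
  refine ⟨p, hp, (1 - t)⁻¹ • (∑ l ∈ G.L, lam l • l + ∑ r ∈ G.R, rho r • r +
    ∑ c ∈ G.C, gam c • c + ∑ p ∈ G.P, pi p • p - t • p), ?_, t, by linarith, by linarith, ?_⟩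
  · refine ⟨fun z => (1 - t)⁻¹ * lam z, fun z => (1 - t)⁻¹ * rho z, fun z => (1 - t)⁻¹ * gam z,
      fun z => (1 - t)⁻¹ * (pi z - if z = p then t else 0), fun z hz => ?_, fun z hz => ?_,
      fun z hz => ?_, ⟨p, hp, ?_⟩, ?_, ?_⟩
    · have := h1 z hz; positivity
    · have := h2 z hz; positivity
    · have := h3 z hz
      refine mul_nonneg (by positivity) ?_
      split_ifs with h
      · subst h; linarith
      · linarith
    · simp only [if_true]
      exact (mul_pos (by positivity) (by linarith)).ne'
    · simp only [← Finset.mul_sum, Finset.sum_sub_distrib, Finset.sum_ite_eq', hp, if_true]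
      rw [← mul_add, ← add_sub_assoc, h5, inv_mul_cancel₀ ht1.ne']
    · simp only [mul_smul, ← Finset.smul_sum, sub_smul, Finset.sum_sub_distrib, ite_smul,
        zero_smul, Finset.sum_ite_eq', hp, if_true]
      module
  · rw [smul_smul, mul_inv_cancel₀ ht1.ne', one_smul, sub_add_cancel]

end Gen

/-! ### Faces and their supports -/

section Faces

variable {S : GenSys n} {a : EuclideanSpace ℝ (Fin n)} {b : ℝ}

theorem le_inner_of_mem_fullGen (hL : ∀ l ∈ S.L, inner ℝ a l = 0) (hR : ∀ r ∈ S.R, 0 ≤ inner ℝ a r)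
    (hC : ∀ c ∈ S.C, b ≤ inner ℝ a c) (hP : ∀ p ∈ S.P, b ≤ inner ℝ a p) :
    ∀ x ∈ fullGen S, b ≤ inner ℝ a x := by
  have : fullGen S ⊆ {x | b ≤ innerSL ℝ a x} := by
    refine fullGen_subset (convex_halfSpace_ge (innerSL ℝ a).isLinear b)
      (fun x hx l hl t => ?_) (fun x hx r hr t ht => ?_) hC hP
    · simp only [Set.mem_ofPred_eq, innerSL_apply_apply, inner_add_right, inner_smul_right, hL l hl,
        mul_zero, add_zero] at hx ⊢
      exact hx
    · simp only [Set.mem_ofPred_eq, innerSL_apply_apply, inner_add_right, inner_smul_right] at hx ⊢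
      have := mul_nonneg ht (hR r hr)
      linarith
  exact this

theorem inner_ray_nonneg (hS : (fullGen S).Nonempty) (h : ∀ x ∈ fullGen S, b ≤ inner ℝ a x)
    {r : EuclideanSpace ℝ (Fin n)} (hr : r ∈ S.R) : 0 ≤ inner ℝ a r := by
  obtain ⟨x, hx⟩ := hS
  by_contra! hlt
  have hbx := h x hx
  -- This multiple of `r` would bring the value of `a` down to `b - 1`.
  have h2 := h _ (add_smul_ray_mem_fullGen hx hr
    (t := (inner ℝ a x - b + 1) / (-inner ℝ a r)) (div_nonneg (by linarith) (by linarith)))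
  rw [inner_add_right, inner_smul_right] at h2
  have h3 : (inner ℝ a x - b + 1) / (-inner ℝ a r) * inner ℝ a r = -(inner ℝ a x - b + 1) := by
    rw [div_neg, neg_mul, div_mul_cancel₀ _ hlt.ne]
  linarith

theorem inner_line_eq_zero (hS : (fullGen S).Nonempty) (h : ∀ x ∈ fullGen S, b ≤ inner ℝ a x)
    {l : EuclideanSpace ℝ (Fin n)} (hl : l ∈ S.L) : inner ℝ a l = 0 := by
  obtain ⟨x, hx⟩ := hS
  by_contra hne
  have h2 := h _ (add_smul_line_mem_fullGen hx hl (-(inner ℝ a x - b + 1) / inner ℝ a l))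
  rw [inner_add_right, inner_smul_right, div_mul_cancel₀ _ hne] at h2
  linarith

variable {F F' : Set (EuclideanSpace ℝ (Fin n))}

theorem subset_of_mem_cFaces {Q : Set (EuclideanSpace ℝ (Fin n))} (hF : F ∈ cFaces Q) : F ⊆ Q := by
  obtain ⟨a, b, -, rfl⟩ := hF
  exact fun x hx => hx.1

theorem convex_of_mem_cFaces {Q : Set (EuclideanSpace ℝ (Fin n))} (hQ : Convex ℝ Q)
    (hF : F ∈ cFaces Q) : Convex ℝ F := by
  obtain ⟨a, b, -, rfl⟩ := hF
  exact hQ.inter (convex_hyperplane (innerSL ℝ a).isLinear b)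

/-- If an inner point of a segment of `Q` lies in a face, then so does the whole segment. -/
theorem mem_face_of_mem_segment {Q : Set (EuclideanSpace ℝ (Fin n))} (hF : F ∈ cFaces Q)
    {x y p : EuclideanSpace ℝ (Fin n)} (hx : x ∈ F) (hy : y ∈ Q) (hp : p ∈ Q) {t : ℝ} (ht : 0 < t)
    (ht1 : t < 1) (h : x = (1 - t) • y + t • p) : p ∈ F := by
  obtain ⟨a, b, hab, rfl⟩ := hF
  refine ⟨hp, ?_⟩
  have h1 := hx.2
  rw [h, inner_add_right, inner_smul_right, inner_smul_right] at h1
  have h2 := hab y hy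
  have h3 := hab p hp
  nlinarith

/-- Staying in `F` for a single step forces `a` to vanish on `r`, and `r` is already a recession
direction of the polyhedron. -/
theorem isRay_face (hF : F ∈ cFaces (fullGen S)) {r : EuclideanSpace ℝ (Fin n)} (hr : r ∈ S.R)
    {p : EuclideanSpace ℝ (Fin n)} (hp : p ∈ F) (hpr : p + r ∈ F) : IsRay F r := by
  obtain ⟨a, b, hab, rfl⟩ := hF
  refine ⟨fun h => S.zero_notMem_R (h ▸ hr), ⟨p, hp⟩, fun q hq t ht => ?_⟩
  refine ⟨add_smul_ray_mem_fullGen hq.1 hr ht, ?_⟩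
  have h1 := hp.2
  have h2 := hpr.2
  rw [inner_add_right] at h2
  have h3 : inner ℝ a r = 0 := by linarith
  rw [inner_add_right, inner_smul_right, h3, hq.2, mul_zero, add_zero]

theorem isLine_face (hF : F ∈ cFaces (fullGen S)) {l : EuclideanSpace ℝ (Fin n)} (hl : l ∈ S.L)
    (hne : F.Nonempty) : IsLine F l := by
  obtain ⟨a, b, hab, rfl⟩ := hF
  have h0 : l ≠ 0 := fun h => S.zero_notMem_L (h ▸ hl)
  have hl0 := inner_line_eq_zero ⟨hne.some, hne.some_mem.1⟩ hab hl
  have key : ∀ q ∈ {x ∈ fullGen S | inner ℝ a x = b}, ∀ t : ℝ,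
      q + t • l ∈ {x ∈ fullGen S | inner ℝ a x = b} := fun q hq t =>
    ⟨add_smul_line_mem_fullGen hq.1 hl t, by
      rw [inner_add_right, inner_smul_right, hl0, hq.2, mul_zero, add_zero]⟩
  refine ⟨⟨h0, hne, fun q hq t _ => key q hq t⟩, ⟨neg_ne_zero.2 h0, hne, fun q hq t _ => ?_⟩⟩
  simpa using key q hq (-t)

/-- A larger set may have fewer rays. Here a ray of `F` supplies `p` and `p + r` in `F'`, which
suffices for a face. -/
theorem support_mono (hF' : F' ∈ cFaces (fullGen S)) (h : F ⊆ F') :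
    support S F ≤ support S F' := by
  classical
  refine ⟨fun l hl => ?_, fun r hr => ?_, Finset.monotone_filter_right _ fun _ _ hc => h hc,
    Finset.monotone_filter_right _ fun _ _ hc => h hc⟩
  · simp only [support, Finset.mem_filter] at hl ⊢
    exact ⟨hl.1, isLine_face hF' hl.1 (hl.2.1.2.1.mono h)⟩
  · simp only [support, Finset.mem_filter] at hr ⊢
    obtain ⟨hr, -, ⟨p, hp⟩, hpr⟩ := hr
    refine ⟨hr, isRay_face hF' hr (h hp) (h ?_)⟩
    simpa using hpr p hp 1 zero_le_one

/-- A face is generated by its support. -/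
theorem fullGen_support (hF : F ∈ cFaces (fullGen S)) : fullGen (support S F) = F := by
  classical
  apply Set.Subset.antisymm
  · refine fullGen_subset (convex_of_mem_cFaces (convex_fullGen S) hF) ?_ ?_ ?_ ?_
    · intro x hx l hl t
      obtain ⟨⟨-, -, h1⟩, -, -, h2⟩ := (Finset.mem_filter.1 hl).2
      rcases le_total 0 t with ht | ht
      · exact h1 x hx t ht
      · simpa using h2 x hx (-t) (by linarith)
    · intro x hx r hr t ht
      exact (Finset.mem_filter.1 hr).2.2.2 x hx t ht
    · exact fun c hc => (Finset.mem_filter.1 hc).2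
    · exact fun c hc => (Finset.mem_filter.1 hc).2
  · intro x hx
    have hF₀ := hF
    obtain ⟨a, b, hab, hFeq⟩ := hF
    have hmem : ∀ {z}, z ∈ F ↔ z ∈ fullGen S ∧ inner ℝ a z = b := fun {z} => by rw [hFeq]; rfl
    have hxF := hx
    obtain ⟨hxS, hxb⟩ := hmem.1 hx
    have hne : (fullGen S).Nonempty := ⟨x, hxS⟩
    obtain ⟨lam, rho, gam, pi, h1, h2, h3, h5, h6⟩ := mem_fullGen_iff.1 hxS
    have hr0 : ∀ r ∈ S.R, 0 ≤ rho r * inner ℝ a r := fun r hr =>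
      mul_nonneg (h1 r hr) (inner_ray_nonneg hne hab hr)
    have hc0 : ∀ c ∈ S.C, 0 ≤ gam c * (inner ℝ a c - b) := fun c hc =>
      mul_nonneg (h2 c hc) (sub_nonneg.2 (hab c (mem_fullGen_of_mem_C hc)))
    have hp0 : ∀ p ∈ S.P, 0 ≤ pi p * (inner ℝ a p - b) := fun p hp =>
      mul_nonneg (h3 p hp) (sub_nonneg.2 (hab p (mem_fullGen_of_mem_P hp)))
    have hl0 : ∑ l ∈ S.L, lam l * inner ℝ a l = 0 := Finset.sum_eq_zero fun l hl => by
      rw [inner_line_eq_zero hne hab hl, mul_zero]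
    -- The excess of `a` over `b` at `x` is a sum of nonnegative terms equal to zero, so every
    -- generator outside the face has coefficient zero.
    have hsum : ∑ r ∈ S.R, rho r * inner ℝ a r + ∑ c ∈ S.C, gam c * (inner ℝ a c - b) +
        ∑ p ∈ S.P, pi p * (inner ℝ a p - b) = 0 := by
      have h := hxb
      rw [h6] at h
      simp only [inner_add_right, inner_sum, inner_smul_right, hl0] at h
      simp only [mul_sub, Finset.sum_sub_distrib, ← Finset.sum_mul]
      linear_combination h - b * h5
    have hR := Finset.sum_nonneg hr0
    have hC := Finset.sum_nonneg hc0
    have hP := Finset.sum_nonneg hp0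
    have hR0 := (Finset.sum_eq_zero_iff_of_nonneg hr0).1 (by linarith)
    have hC0 := (Finset.sum_eq_zero_iff_of_nonneg hc0).1 (by linarith)
    have hP0 := (Finset.sum_eq_zero_iff_of_nonneg hp0).1 (by linarith)
    have hRf : ∀ r ∈ S.R, rho r ≠ 0 → IsRay F r := by
      intro r hr hne0
      have := (mul_eq_zero.1 (hR0 r hr)).resolve_left hne0
      refine isRay_face hF₀ hr hxF (hmem.2 ⟨?_, ?_⟩)
      · simpa using add_smul_ray_mem_fullGen hxS hr zero_le_one
      · rw [inner_add_right, this, hxb, add_zero]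
    have hCf : ∀ c ∈ S.C, gam c ≠ 0 → c ∈ F := fun c hc hne0 =>
      hmem.2 ⟨mem_fullGen_of_mem_C hc,
        sub_eq_zero.1 ((mul_eq_zero.1 (hC0 c hc)).resolve_left hne0)⟩
    have hPf : ∀ c ∈ S.P, pi c ≠ 0 → c ∈ F := fun c hc hne0 =>
      hmem.2 ⟨mem_fullGen_of_mem_P hc,
        sub_eq_zero.1 ((mul_eq_zero.1 (hP0 c hc)).resolve_left hne0)⟩
    refine mem_fullGen_iff.2 ⟨lam, rho, gam, pi, fun r hr => h1 r (Finset.mem_filter.1 hr).1,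
      fun r hr => h2 r (Finset.mem_filter.1 hr).1, fun r hr => h3 r (Finset.mem_filter.1 hr).1,
      ?_, ?_⟩
    · simp only [support]
      rw [Finset.sum_filter_of_ne hCf, Finset.sum_filter_of_ne hPf, h5]
    · simp only [support]
      rw [Finset.filter_true_of_mem fun l hl => isLine_face hF₀ hl ⟨x, hxF⟩,
        Finset.sum_filter_of_ne fun r hr h => hRf r hr (left_ne_zero_of_smul h),
        Finset.sum_filter_of_ne fun r hr h => hCf r hr (left_ne_zero_of_smul h),
        Finset.sum_filter_of_ne fun r hr h => hPf r hr (left_ne_zero_of_smul h)]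
      exact h6

/-- A face of a face of a polyhedron is a face of the polyhedron. -/
theorem cFaces_of_cFaces (hF : F ∈ cFaces (fullGen S)) (hF' : F' ∈ cFaces F) (hne : F.Nonempty) :
    F' ∈ cFaces (fullGen S) := by
  classical
  have hF₀ := hF
  have hgen := fullGen_support hF
  obtain ⟨a', b', hab', rfl⟩ := hF'
  obtain ⟨a, b, hab, hFeq⟩ := hF
  have hmem : ∀ {z}, z ∈ F ↔ z ∈ fullGen S ∧ inner ℝ a z = b := fun {z} => by rw [hFeq]; rfl
  have hSne : (fullGen S).Nonempty := hne.mono fun x hx => (hmem.1 hx).1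
  have hab'' := hab'
  rw [← hgen] at hab''
  have hne' := hne
  rw [← hgen] at hne'
  -- For large `K`, `K • a + a'` is valid on the whole polyhedron: where `a` has positive excess `K`
  -- dominates, elsewhere the generator belongs to `F` and `a'` is valid. Finitely many generators
  -- allow one common `K`.
  have ev : ∀ u v : ℝ, 0 ≤ u → (u = 0 → 0 ≤ v) → ∀ᶠ K : ℝ in Filter.atTop, 0 ≤ K * u + v := by
    intro u v hu huv
    obtain rfl | hu := hu.eq_or_lt
    · filter_upwards with K
      simpa using huv rfl
    · filter_upwards [Filter.eventually_ge_atTop (-v / u)] with K hK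
      rw [div_le_iff₀ hu] at hK
      linarith
  have evR : ∀ᶠ K : ℝ in Filter.atTop, ∀ r ∈ S.R, 0 ≤ K * inner ℝ a r + inner ℝ a' r := by
    refine (Filter.eventually_all_finset _).2 fun r hr => ev _ _ (inner_ray_nonneg hSne hab hr) ?_
    intro h0
    refine inner_ray_nonneg hne' hab'' (Finset.mem_filter.2 ⟨hr, ?_⟩)
    obtain ⟨x, hx⟩ := hne
    refine isRay_face hF₀ hr hx (hmem.2 ⟨?_, ?_⟩)
    · simpa using add_smul_ray_mem_fullGen (hmem.1 hx).1 hr zero_le_one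
    · rw [inner_add_right, h0, (hmem.1 hx).2, add_zero]
  have evp : ∀ c ∈ fullGen S, ∀ᶠ K : ℝ in Filter.atTop,
      0 ≤ K * (inner ℝ a c - b) + (inner ℝ a' c - b') := by
    intro c hc
    refine ev _ _ (sub_nonneg.2 (hab c hc)) fun h0 => sub_nonneg.2 (hab' c (hmem.2 ⟨hc, by linarith⟩))
  have evC := (Filter.eventually_all_finset S.C).2 fun c hc => evp c (mem_fullGen_of_mem_C hc)
  have evP := (Filter.eventually_all_finset S.P).2 fun c hc => evp c (mem_fullGen_of_mem_P hc)
  obtain ⟨K, hKR, hKC, hKP⟩ := (evR.and (evC.and evP)).exists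
  have hK : ∀ x ∈ fullGen S, K * b + b' ≤ inner ℝ (K • a + a') x := by
    apply le_inner_of_mem_fullGen
    · intro l hl
      have h1 := inner_line_eq_zero hSne hab hl
      have h2 := inner_line_eq_zero hne' hab''
        (Finset.mem_filter.2 ⟨hl, isLine_face hF₀ hl hne⟩)
      rw [inner_add_left, real_inner_smul_left, h1, h2]
      ring
    · intro r hr
      rw [inner_add_left, real_inner_smul_left]
      exact hKR r hr
    · intro c hc
      rw [inner_add_left, real_inner_smul_left]
      linarith [hKC c hc]
    · intro c hc
      rw [inner_add_left, real_inner_smul_left]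
      linarith [hKP c hc]
  simp only [inner_add_left, real_inner_smul_left] at hK
  -- The extra copy of `a` makes equality force `inner ℝ a x = b`, that is, `x ∈ F`.
  refine ⟨(K + 1) • a + a', (K + 1) * b + b', fun x hx => ?_, ?_⟩
  · rw [inner_add_left, real_inner_smul_left]
    linarith [hK x hx, hab x hx]
  · ext x
    simp only [Set.mem_ofPred_eq, hmem, inner_add_left, real_inner_smul_left]
    constructor
    · rintro ⟨⟨h1, h2⟩, h3⟩
      exact ⟨h1, by rw [h2, h3]⟩
    · rintro ⟨h1, h2⟩
      have h3 := hK x h1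
      have h4 := hab x h1
      have h5 : inner ℝ a x = b := by linarith
      exact ⟨⟨h1, h5⟩, by rw [h5] at h2; linarith⟩

end Faces

/-! ### Minimal forms, minimal faces and the skeleton -/

/-- The number of generators of a system. -/
def size (G : GenSys n) : ℕ := G.L.card + G.R.card + G.C.card + G.P.card

theorem eq_of_le_of_size_le {G G' : GenSys n} (h : G ≤ G') (hs : G'.size ≤ G.size) : G = G' := by
  obtain ⟨h1, h2, h3, h4⟩ := h
  have c1 := Finset.card_le_card h1
  have c2 := Finset.card_le_card h2
  have c3 := Finset.card_le_card h3
  have c4 := Finset.card_le_card h4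
  unfold size at hs
  exact GenSys.ext (Finset.eq_of_subset_of_card_le h1 (by omega))
    (Finset.eq_of_subset_of_card_le h2 (by omega)) (Finset.eq_of_subset_of_card_le h3 (by omega))
    (Finset.eq_of_subset_of_card_le h4 (by omega))

theorem size_mono {G G' : GenSys n} (h : G ≤ G') : G.size ≤ G'.size :=
  add_le_add (add_le_add (add_le_add (Finset.card_le_card h.1) (Finset.card_le_card h.2.1))
    (Finset.card_le_card h.2.2.1)) (Finset.card_le_card h.2.2.2)

theorem exists_isMinimalForm (G : GenSys n) : ∃ Gm : GenSys n, Gm.IsMinimalForm ∧ gen Gm = gen G := by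
  obtain ⟨Gm, hGm, hmin⟩ := exists_minimalFor_of_wellFoundedLT (fun H : GenSys n => gen H = gen G)
    size ⟨G, rfl⟩
  refine ⟨Gm, fun G' hle hgen => ?_, hGm⟩
  have := hmin (hgen.trans hGm)
  refine eq_of_le_of_size_le hle (this (size_mono hle))

/-- Every point of a polyhedron is in the relative interior of one of its faces. -/
theorem exists_face_mem_intrinsicInterior {S : GenSys n} {x : EuclideanSpace ℝ (Fin n)}
    (hx : x ∈ fullGen S) : ∃ F ∈ cFaces (fullGen S), x ∈ intrinsicInterior ℝ F := by
  -- Among the faces through `x`, take one with smallest support. Were `x` not in its relative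
  -- interior, a supporting hyperplane would cut out a proper subface through `x`, whose support is
  -- strictly smaller.
  obtain ⟨F, ⟨hF, hxF⟩, hmin⟩ := exists_minimalFor_of_wellFoundedLT
    (fun F => F ∈ cFaces (fullGen S) ∧ x ∈ F) (fun F => (support S F).size)
    ⟨fullGen S, ⟨0, 0, by simp, by simp⟩, hx⟩
  refine ⟨F, hF, ?_⟩
  by_contra hxi
  obtain ⟨a, ha, y, hy, hxy⟩ := (convex_of_mem_cFaces (convex_fullGen S)
    hF).exists_supporting_of_notMem_intrinsicInterior hxF hxi
  have hF'F : {z ∈ F | inner ℝ a z = inner ℝ a x} ∈ cFaces F := ⟨a, _, ha, rfl⟩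
  have hF' := cFaces_of_cFaces hF hF'F ⟨x, hxF⟩
  have hle := support_mono hF (subset_of_mem_cFaces hF'F)
  have hs := hmin ⟨hF', hxF, rfl⟩ (size_mono hle)
  have heq := congrArg fullGen (eq_of_le_of_size_le hle hs)
  rw [fullGen_support hF', fullGen_support hF] at heq
  rw [← heq] at hy
  exact hxy.ne' hy.2

/-- A face that meets the relative interior of another face contains it. -/
theorem face_subset_of_mem_intrinsicInterior {Q F F' : Set (EuclideanSpace ℝ (Fin n))}
    (hF : F ∈ cFaces Q) (hF' : F' ∈ cFaces Q) {p : EuclideanSpace ℝ (Fin n)}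
    (hp : p ∈ intrinsicInterior ℝ F) (hpF' : p ∈ F') : F ⊆ F' := by
  intro z hz
  obtain ⟨y, hy, t, ht, ht1, h⟩ := exists_prolongation_of_mem_intrinsicInterior hp hz
  exact mem_face_of_mem_segment hF' hpF' (subset_of_mem_cFaces hF hy)
    (subset_of_mem_cFaces hF hz) ht ht1 h

-- Otherwise `p` could be replaced by its expression in the other generators, and a proper subsystem
-- would generate the same polyhedron.
open Classical in
theorem IsMinimalForm.notMem_gen_erase {G : GenSys n} (hG : G.IsMinimalForm)
    {p : EuclideanSpace ℝ (Fin n)} (hp : p ∈ G.P) :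
    p ∉ gen ⟨G.L, G.R, G.C, G.P.erase p, G.zero_notMem_L, G.zero_notMem_R⟩ := by
  intro h
  set G' : GenSys n := ⟨G.L, G.R, G.C, G.P.erase p, G.zero_notMem_L, G.zero_notMem_R⟩ with hG'
  have hle : G' ≤ G := ⟨subset_rfl, subset_rfl, subset_rfl, Finset.erase_subset _ _⟩
  have hsub : ∀ {q}, q ∈ G.P → q ∈ gen G' := by
    intro q hq
    by_cases hqp : q = p
    · exact hqp ▸ h
    · exact mem_gen_of_mem_P (Finset.mem_erase.2 ⟨hqp, hq⟩)
  have hfull : fullGen G ⊆ fullGen G' :=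
    fullGen_subset (convex_fullGen G') (fun x hx l hl t => add_smul_line_mem_fullGen hx hl t)
      (fun x hx r hr t ht => add_smul_ray_mem_fullGen hx hr ht)
      (fun c hc => mem_fullGen_of_mem_C hc) (fun q hq => gen_subset_fullGen _ (hsub hq))
  have hgen : gen G' = gen G := by
    apply Set.Subset.antisymm
    · rintro x ⟨lam, rho, gam, pi, h1, h2, h3, ⟨q, hq, hq0⟩, h5, h6⟩
      have hpi : ∀ {M : Type} [AddCommMonoid M] (f : EuclideanSpace ℝ (Fin n) → M),
          ∑ q ∈ G.P, (if q = p then 0 else f q) = ∑ q ∈ G.P.erase p, f q := by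
        intro M _ f
        rw [← Finset.add_sum_erase _ _ hp, if_pos rfl, zero_add]
        exact Finset.sum_congr rfl fun q hq => if_neg (Finset.ne_of_mem_erase hq)
      refine ⟨lam, rho, gam, fun q => if q = p then 0 else pi q, h1, h2, fun q hq => ?_,
        ⟨q, Finset.mem_of_mem_erase hq, ?_⟩, ?_, ?_⟩
      · dsimp only
        split_ifs with hqp
        exacts [le_rfl, h3 q (Finset.mem_erase.2 ⟨hqp, hq⟩)]
      · simpa [Finset.ne_of_mem_erase hq] using hq0
      · rw [hpi]
        exact h5
      · simp only [ite_smul, zero_smul]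
        rw [hpi]
        exact h6
    · intro x hx
      obtain ⟨q, hq, y, hy, t, ht, ht1, rfl⟩ := exists_point_of_mem_gen hx
      -- Only `q` has to lie in `gen G'`; for `y` the closed polyhedron is enough.
      exact mix_mem_gen (hfull (gen_subset_fullGen _ hy)) (hsub hq) (by linarith) ht (by ring)
  have hP : G.P.erase p = G.P := congrArg GenSys.P (hG G' hle hgen)
  exact Finset.notMem_erase p G.P (by rw [hP]; exact hp)

/-- In minimal form, the skeleton generates the same closed polyhedron. -/
theorem IsMinimalForm.fullGen_skel {G : GenSys n} (hG : G.IsMinimalForm) :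
    fullGen (skel G) = fullGen G := by
  classical
  have hC : ∀ {c}, c ∈ G.C → c ∈ (skel G).C := fun hc => Finset.mem_union_left _ hc
  have hmono : ∀ {p}, p ∈ (skel G).C → p ∈ fullGen G := fun hp =>
    (Finset.mem_union.1 hp).elim mem_fullGen_of_mem_C
      fun h => mem_fullGen_of_mem_P (Finset.mem_filter.1 h).1
  apply Set.Subset.antisymm
  · exact fullGen_subset (convex_fullGen G) (fun x hx l hl t => add_smul_line_mem_fullGen hx hl t)
      (fun x hx r hr t ht => add_smul_ray_mem_fullGen hx hr ht) (fun c hc => hmono hc)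
      (fun q hq => absurd hq (Finset.notMem_empty q))
  · refine fullGen_subset (convex_fullGen _)
      (fun x hx l hl t => add_smul_line_mem_fullGen (G := skel G) hx hl t)
      (fun x hx r hr t ht => add_smul_ray_mem_fullGen (G := skel G) hx hr ht)
      (fun c hc => mem_fullGen_of_mem_C (hC hc))
      (fun p hp => ?_)
    by_cases hps : p ∈ skelPoints G
    · exact mem_fullGen_of_mem_C (G := skel G) (Finset.mem_union_right _ hps)
    have hpf : p ∈ fullGen ⟨G.L, G.R, G.C, G.P.erase p, G.zero_notMem_L, G.zero_notMem_R⟩ := by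
      by_contra h
      exact hps (Finset.mem_filter.2 ⟨hp, by convert h⟩)
    obtain ⟨lam, rho, gam, pi, h1, h2, h3, h5, h6⟩ := mem_fullGen_iff.1 hpf
    -- A combination using another point would make `p` redundant, against minimality. So it uses
    -- closure points only, and these survive in the skeleton.
    by_cases hz : ∃ q ∈ G.P.erase p, pi q ≠ 0
    · exact absurd ⟨lam, rho, gam, pi, h1, h2, h3, by convert hz, h5, h6⟩ (hG.notMem_gen_erase hp)
    · push Not at hz
      have hpC : p ∈ fullGen ⟨G.L, G.R, G.C, ∅, G.zero_notMem_L, G.zero_notMem_R⟩ := by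
        refine mem_fullGen_iff.2 ⟨lam, rho, gam, 0, h1, h2, by simp, ?_, ?_⟩
        · rw [Finset.sum_eq_zero hz] at h5
          simpa using h5
        · rw [Finset.sum_eq_zero (s := G.P.erase p) fun q hq => by rw [hz q hq, zero_smul]] at h6
          simpa using h6
      refine fullGen_subset (G := ⟨G.L, G.R, G.C, ∅, G.zero_notMem_L, G.zero_notMem_R⟩) (convex_fullGen _)
        (fun x hx l hl t => add_smul_line_mem_fullGen (G := skel G) hx hl t)
        (fun x hx r hr t ht => add_smul_ray_mem_fullGen (G := skel G) hx hr ht)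
        (fun c hc => mem_fullGen_of_mem_C (hC hc))
        (fun q hq => absurd hq (Finset.notMem_empty q)) hpC

end GenSys

theorem mainTheorem2 (n : ℕ) (G : GenSys n) :
    (∃ SK : GenSys n, SK.IsSkeleton G) ∧
      ∀ SK : GenSys n, SK.IsSkeleton G →
        G.gen = GenSys.concretization SK (GenSys.nonSkel SK G) := by
  open GenSys in
  constructor
  · obtain ⟨Gm, hmin, hgen⟩ := exists_isMinimalForm G
    exact ⟨skel Gm, Gm, hmin, hgen, rfl⟩
  rintro SK ⟨Gm, hmin, hgen, rfl⟩
  have hQ := hmin.fullGen_skel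
  have hsub : gen G ⊆ fullGen (skel Gm) := by
    rw [← hgen, hQ]
    exact gen_subset_fullGen Gm
  ext x
  simp only [concretization, Set.mem_iUnion]
  constructor
  · intro hx
    obtain ⟨p, hp, y, hy, t, ht, ht1, hxy⟩ := exists_point_of_mem_gen hx
    have hpQ := hsub (mem_gen_of_mem_P hp)
    obtain ⟨F', hF', hxF'⟩ := exists_face_mem_intrinsicInterior (hsub hx)
    obtain ⟨F, hF, hpF⟩ := exists_face_mem_intrinsicInterior hpQ
    have hpF' : p ∈ F' := mem_face_of_mem_segment hF' (intrinsicInterior_subset hxF') (hsub hy)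
      hpQ ht ht1 hxy
    refine ⟨⟨support (skel Gm) F', F', hF', rfl⟩, ⟨p, hp, F, hF, hpF, ?_⟩, ?_⟩
    · exact support_mono hF' (face_subset_of_mem_intrinsicInterior hF hF' hpF hpF')
    · rwa [fullGen_support hF']
  · rintro ⟨⟨_, F', hF', rfl⟩, ⟨p, hp, F, hF, hpF, hle⟩, hx⟩
    rw [fullGen_support hF'] at hx
    -- Inclusion of supports yields inclusion of the faces they generate.
    have hpF' : p ∈ F' := by
      rw [← fullGen_support hF']
      have hpS : p ∈ fullGen (support (skel Gm) F) := by
        rw [fullGen_support hF]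
        exact intrinsicInterior_subset hpF
      exact fullGen_subset (convex_fullGen _)
        (fun x hx l hl t => add_smul_line_mem_fullGen hx (hle.1 hl) t)
        (fun x hx r hr t ht => add_smul_ray_mem_fullGen hx (hle.2.1 hr) ht)
        (fun c hc => mem_fullGen_of_mem_C (hle.2.2.1 hc))
        (fun c hc => mem_fullGen_of_mem_P (hle.2.2.2 hc)) hpS
    obtain ⟨y, hy, t, ht, ht1, rfl⟩ := exists_prolongation_of_mem_intrinsicInterior hx hpF'
    rw [← hgen]
    -- `p` need not be a generator of `Gm`; its membership in `gen Gm = gen G` is what counts.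
    refine mix_mem_gen ?_ ?_ (by linarith) ht (by ring)
    · rw [← hQ]
      exact subset_of_mem_cFaces hF' hy
    · rw [hgen]
      exact mem_gen_of_mem_P hp
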